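/- **Conventions.** Let $m\ge 2$ and $n\ge 1$. The Sierpinski graph $S(n,m)$ has vertex set $V=\{0,1,\dots,m-1\}^n$; vertices $u,v$ are adjacent iff there is $h\in\{1,\dots,n\}$ with $u_i=v_i$ for $i<h$, $u_h\ne v_h$, and $u_j=v_h$, $v_j=u_h$ for all $j>h$. The corner vertices are $i^n=(i,\dots,i)$, $0\le i<m$. For a graph $G$ and a set $S$ of vertices, $\Theta(S)$ denotes the set of edges of $G$ with exactly one end in $S$. For $0\le\ell\le m^n$ let $L_{n,m}(\ell)\subseteq V$ be the set of the first $\ell$ vertices in lexicographic order, let $\theta_{n,m}(\ell)=|\Theta(L_{n,m}(\ell))|$, computed in $S(n,m)$, and let $q_{n,m}(\ell)$ be the number of corner vertices in $L_{n,m}(\ell)$. For $0\le b\le a\le m^n$ put $$\sigma_{n,m}(a,b)=\begin{cases} q_{n,m}(b)+q_{n,m}(a+b)-q_{n,m}(a) & \text{if } a+b<m^n,\\ q_{n,m}(b)-q_{n,m}(a+b-m^n)+m-q_{n,m}(a) & \text{if } a+b\ge m^n.\end{cases}$$ The function $\theta_{n,m}$ is called *subadditive+$\sigma$* if for all integers $a,b$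 with $m^n\ge a\ge b>0$: $$\theta_{n,m}(a+b)+\sigma_{n,m}(a,b)\le\theta_{n,m}(a)+\theta_{n,m}(b)\quad\text{if } a+b\le m^n,$$ $$\theta_{n,m}(a+b-m^n)+\sigma_{n,m}(a,b)\le\theta_{n,m}(a)+\theta_{n,m}(b)\quad\text{if } a+b\ge m^n.$$ For integers $s,t\ge 0$ with $s+t\le m$ put $I=\{0,\dots,s-1\}$ and $K=\{s+t,\dots,m-1\}$. The decorated Sierpinski graph $S_{s,t}(n,m)$ is $S(n,m)$ together with a new vertex $v_i$ and an exterior edge $\{v_i,i^n\}$ for every $i\in I\cup K$. For $S\subseteq V$, $\Theta_{s,t}(S)$ is the edge-boundary in $S_{s,t}(n,m)$ of $S\cup\{v_i: i\in I\}$; that is, $v_i$ is treated as a member of $S$ for $i\in I$ and as a non-member for $i\in K$ (without being counted in $|S|$). **Theorem.** Let $m\ge 2$. Suppose that $\theta_{n,m}$ is subadditive+$\sigma$ for every $n\ge 1$. Then for all $n\ge1$, all $s,t\ge 0$ with $s+t\le m$ and all $0\le\ell\le m^n$, the initial lexicographic segments solve the edge-isoperimetric problem on $S_{s,t}(n,m)$: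 $$|\Theta_{s,t}(L_{n,m}(\ell))|=\min\{|\Theta_{s,t}(S)| : S\subseteq V,\ |S|=\ell\},$$ where $|L_{n,m}(\ell)|=\ell$. -/

import Mathlib

namespace SierpinskiEIP

/-- The generalized (extended) Sierpinski graph `S(n,m)` on `{0,…,m-1}ⁿ`: the vertices `u`, `v` are
adjacent iff for some coordinate `h` they agree before `h`, differ at `h`, and every later
coordinate of `u` is `v h` and every later coordinate of `v` is `u h`. -/
def sierpinski (n m : ℕ) : SimpleGraph (Fin n → Fin m) where
  Adj u v := ∃ h : Fin n, (∀ i, i < h → u i = v i) ∧ u h ≠ v h ∧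
    ∀ j, h < j → u j = v h ∧ v j = u h
  symm := ⟨fun _ _ ⟨h, h1, h2, h3⟩ =>
    ⟨h, fun i hi => (h1 i hi).symm, h2.symm, fun j hj => (h3 j hj).symm⟩⟩
  loopless := ⟨fun _ ⟨_, _, h2, _⟩ => h2 rfl⟩

/-- The edge-boundary `Θ(A)`: the edges of `G` with one end in `A` and the other end outside. -/
def edgeBoundary {V : Type*} (G : SimpleGraph V) (A : Set V) : Set (Sym2 V) :=
  {e | e ∈ G.edgeSet ∧ ∃ v w, e = s(v, w) ∧ v ∈ A ∧ w ∉ A}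

/-- The lexicographic number of a vertex (from `1` to `mⁿ`): the number of vertices that are
lexicographically at most `v`, the first coordinate being the most significant one. -/
noncomputable def lexNumber {n m : ℕ} (v : Fin n → Fin m) : ℕ :=
  Set.ncard {w : Fin n → Fin m | toLex w ≤ toLex v}

/-- The initial `ℓ`-segment of the lexicographic order on the vertices. -/
noncomputable def lexInit (n m ℓ : ℕ) : Finset (Fin n → Fin m) :=
  Finset.univ.filter fun v => lexNumber v ≤ ℓ

/-- The corner vertex `iⁿ = (i,…,i)`. -/
def corner (n : ℕ) {m : ℕ} (i : Fin m) : Fin n → Fin m := fun _ => i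

/-- `q_{n,m}(ℓ)`: the number of corner vertices in the initial lexicographic `ℓ`-segment. -/
noncomputable def cornerCount (n m ℓ : ℕ) : ℕ :=
  Set.ncard {v : Fin n → Fin m | v ∈ lexInit n m ℓ ∧ ∃ i : Fin m, v = corner n i}

/-- The size of the edge-boundary, in `S(n,m)`, of the initial lexicographic `ℓ`-segment. -/
noncomputable def lexBoundary (n m ℓ : ℕ) : ℕ :=
  (edgeBoundary (sierpinski n m) (lexInit n m ℓ : Set (Fin n → Fin m))).ncard

/-- The correction term `σ_{n,m}(a,b)`, for `b ≤ a ≤ mⁿ`. -/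
noncomputable def sigma (n m a b : ℕ) : ℤ :=
  if a + b < m ^ n then
    (cornerCount n m b : ℤ) + ((cornerCount n m (a + b) : ℤ) - cornerCount n m a)
  else
    (cornerCount n m b : ℤ) - cornerCount n m (a + b - m ^ n) + ((m : ℤ) - cornerCount n m a)

/-- The size of the edge-boundary of initial lexicographic segments of `S(n,m)`, as a function of
their cardinality, is subadditive+σ. -/
def SubadditivePlusSigma (n m : ℕ) : Prop :=
  ∀ a b : ℕ, a ≤ m ^ n → b ≤ a → 0 < b →
    (a + b ≤ m ^ n →
      (lexBoundary n m (a + b) : ℤ) + sigma n m a b ≤ lexBoundary n m a + lexBoundary n m b) ∧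
    (m ^ n ≤ a + b →
      (lexBoundary n m (a + b - m ^ n) : ℤ) + sigma n m a b
        ≤ lexBoundary n m a + lexBoundary n m b)

/-- The vertices of the decorated graph: those of `S(n,m)`, and one exterior vertex `v_i` for every
`i ∈ I ∪ K`, where `I = {0,…,s-1}` and `K = {s+t,…,m-1}`. -/
abbrev DecoratedVertex (n m s t : ℕ) : Type :=
  (Fin n → Fin m) ⊕ {i : Fin m // (i : ℕ) < s ∨ s + t ≤ (i : ℕ)}

/-- Adjacency in the decorated graph: the edges of `S(n,m)` and the exterior edges `{v_i, iⁿ}`. -/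
def decoratedAdj (n m s t : ℕ) : DecoratedVertex n m s t → DecoratedVertex n m s t → Prop
  | .inl u, .inl v => (sierpinski n m).Adj u v
  | .inl u, .inr i => u = corner n i.1
  | .inr i, .inl u => u = corner n i.1
  | .inr _, .inr _ => False

/-- The decorated Sierpinski graph `S_{s,t}(n,m)`. -/
def decoratedSierpinski (n m s t : ℕ) : SimpleGraph (DecoratedVertex n m s t) where
  Adj := decoratedAdj n m s t
  symm := ⟨by
    rintro (u | i) (v | j) h
    · exact (sierpinski n m).adj_symm h
    · exact h
    · exact h
    · exact h⟩
  loopless := ⟨by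
    rintro (u | i) h
    · exact (sierpinski n m).loopless.irrefl u h
    · exact h⟩

/-- `S` together with the exterior vertices that count as members of it, namely `v_i`, `i ∈ I`. -/
def withExterior {n m : ℕ} (s t : ℕ) (S : Finset (Fin n → Fin m)) :
    Set (DecoratedVertex n m s t) :=
  {x | (∃ u ∈ S, x = .inl u) ∨ ∃ i, (i.1 : ℕ) < s ∧ x = .inr i}

/-- `|Θ_{s,t}(S)|`: the size of the edge-boundary of `S` in `S_{s,t}(n,m)`, where `v_i` counts as a
member of `S` for `i ∈ I` and as a non-member for `i ∈ K`. -/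
noncomputable def decoratedBoundary {n m : ℕ} (s t : ℕ) (S : Finset (Fin n → Fin m)) : ℕ :=
  (edgeBoundary (decoratedSierpinski n m s t) (withExterior s t S)).ncard

end SierpinskiEIP

/-!
Write `θ(S)` for the size of the edge-boundary of `S` in `S(n,m)`, `C(S)` for the set of letters `i`
with `iⁿ ∈ S`, `q(S) = |C(S)|`, and `θ(ℓ)`, `q(ℓ)` for the values at the initial segment of size
`ℓ`. With `I = {i < s}` and `J = {i < s + t}`, the decorated boundary of `S` is
`θ(S) + |I \ C(S)| + |C(S) \ J|` (`decoratedBoundary_eq`). As the letters of a lexicographic initial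
segment form an initial interval, the theorem for all `s`, `t` follows from the single inequality
`θ(S) ≥ θ(|S|) + |q(S) - q(|S|)|` (`boundaryCard_lexInit_add_le`), which is proved by induction
on `n`.

Cut `S ⊆ {0,…,m-1}ⁿ⁺¹` into slices `Sᵢ` by the first letter and put `Cᵢ = C(Sᵢ)`. The copies `i ≠ j`
of `S(n,m)` are joined by the one edge from the corner `j` of copy `i` to the corner `i` of copy `j`,
and the corner `i` of copy `i` is a corner of the whole graph. Hence each of `θ(S) + q(S)` and
`θ(S) + m - q(S)`, whose lower bounds together give the absolute value, is the sum of the `θ(Sᵢ)` and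
of a cost depending only on the sets `Cᵢ` (`boundaryCard_add_cornerCost`). That cost is 1-Lipschitz in
the `Cᵢ` (`linkCost_le_add`), so by the induction hypothesis `θ(Sᵢ)` may be replaced by `θ(|Sᵢ|)` and
`Cᵢ` by a set of `q(|Sᵢ|)` letters. Two slices of sizes `0 < b ≤ a < mⁿ` can then be merged into
slices of sizes `a + b` and `0`, or `mⁿ` and `a + b - mⁿ`: by the Lipschitz bound the cost of the links
grows by at most `σ(a,b)`, and subadditivity+σ says that the sum of the `θ` drops by at least as much
(`exists_merge`). Once at most one slice is neither full nor empty, the total is bounded below by the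
value attained by the initial segment (`exists_segmentCost_le`, `lexInit_segmentCost`).

The induction starts at `n = 0`, where corners are counted by their letters (all `m` letters name the
one vertex) and no slice size lies strictly between `0` and `m⁰ = 1`, so that subadditivity is not
needed for the step to `n = 1`.
-/

open Finset

namespace SierpinskiEIP

variable {n m : ℕ}

/-! ### Edge-boundaries as sums over ordered pairs -/

theorem edgeBoundary_ncard {V : Type*} [Fintype V] [DecidableEq V] (G : SimpleGraph V)
    [DecidableRel G.Adj] (A : Set V) [DecidablePred (· ∈ A)] :
    ((edgeBoundary G A).ncard : ℤ) = ∑ u, ∑ v, if u ∈ A ∧ v ∉ A ∧ G.Adj u v then 1 else 0 := by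
  have h : edgeBoundary G A =
      ↑((univ.filter fun p : V × V => p.1 ∈ A ∧ p.2 ∉ A ∧ G.Adj p.1 p.2).image
        fun p => s(p.1, p.2)) := by
    ext e
    simp only [edgeBoundary, Set.mem_ofPred_eq, coe_image, coe_filter, mem_univ, true_and,
      Set.mem_image, Prod.exists]
    constructor
    · rintro ⟨he, v, w, rfl, hv, hw⟩
      exact ⟨v, w, ⟨hv, hw, he⟩, rfl⟩
    · rintro ⟨v, w, ⟨hv, hw, he⟩, rfl⟩
      exact ⟨he, v, w, rfl, hv, hw⟩
  rw [h, Set.ncard_coe_finset, card_image_of_injOn, card_filter, Fintype.sum_prod_type]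
  · push_cast
    rfl
  · rintro ⟨u, v⟩ h1 ⟨u', v'⟩ h2 h3
    simp only [coe_filter, mem_univ, true_and, Set.mem_ofPred_eq] at h1 h2
    simp only [Sym2.eq_iff] at h3
    rcases h3 with ⟨rfl, rfl⟩ | ⟨rfl, rfl⟩
    · rfl
    · exact absurd h1.1 h2.2.1

theorem edgeBoundary_empty {V : Type*} (G : SimpleGraph V) : edgeBoundary G ∅ = ∅ := by
  simp [edgeBoundary]

theorem edgeBoundary_univ {V : Type*} (G : SimpleGraph V) : edgeBoundary G Set.univ = ∅ := by
  simp [edgeBoundary]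

/-! ### The cost of the links between the copies -/

/-- Let `C i` be the set of letters `j` such that corner `j` of copy `i` is selected. For `i ≠ j` this
is `1` if the edge joining the copies `i` and `j` leaves the selection from the side of `i`, so that a
cut edge is counted at exactly one of `(i, j)` and `(j, i)`. For `i = j` it is the contribution of an
exterior edge at the corner `i` of copy `i` whose outer end is selected iff `e = true`. -/
def clashCost (e : Bool) (C : Fin m → Finset (Fin m)) (i j : Fin m) : ℤ :=
  if i = j then (if decide (i ∈ C i) = e then 0 else 1)
  else if j ∈ C i ∧ i ∉ C j then 1 else 0

/-- The number of cut edges between the copies, together with the exterior edges cut when all the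
exterior vertices are selected (`e = true`) or none is (`e = false`). -/
def linkCost (e : Bool) (C : Fin m → Finset (Fin m)) : ℤ := ∑ i, ∑ j, clashCost e C i j

theorem sum_ite_sdiff (A B : Finset (Fin m)) :
    (∑ j, if j ∈ A ∧ j ∉ B then (1 : ℤ) else 0) = #(A \ B) := by
  rw [← Finset.sum_filter, Finset.sum_const, nsmul_one]
  congr 2
  ext; simp

/-- The link cost is 1-Lipschitz for the total size of the symmetric differences. -/
theorem linkCost_le_add (e : Bool) (C D : Fin m → Finset (Fin m)) :
    linkCost e C ≤ linkCost e D + ∑ i, ((#(C i \ D i) : ℤ) + #(D i \ C i)) := by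
  -- The cost of the pair `(i, j)` is raised by gaining `j` in row `i` or by losing `i` in row `j`;
  -- transposing the sum turns the second charge into a row sum as well.
  have h : linkCost e C ≤ ∑ i, ∑ j, (clashCost e D i j +
      ((if j ∈ C i ∧ j ∉ D i then 1 else 0) + if i ∈ D j ∧ i ∉ C j then 1 else 0)) := by
    refine sum_le_sum fun i _ => sum_le_sum fun j _ => ?_
    unfold clashCost
    by_cases hij : i = j
    · subst hij
      cases e <;> by_cases h1 : i ∈ C i <;> by_cases h2 : i ∈ D i <;> simp [h1, h2]
    · by_cases h1 : j ∈ C i <;> by_cases h2 : j ∈ D i <;> by_cases h3 : i ∈ C j <;>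
        by_cases h4 : i ∈ D j <;> simp [h1, h2, h3, h4, hij]
  refine h.trans_eq ?_
  simp only [sum_add_distrib]
  rw [sum_comm (f := fun i j => if i ∈ D j ∧ i ∉ C j then (1 : ℤ) else 0)]
  simp only [sum_ite_sdiff]
  rfl

/-- The link cost when every row but `i₀` is full or empty. Here `P` consists of the full rows, and also
of `i₀` if the exterior vertices are selected: among the vertices `P` and `Pᶜ` of a complete graph
there are `|P| (m - |P|)` cut edges, and each corner of the copy `i₀` that disagrees with the side of
its letter costs one more. -/
theorem linkCost_eq (e : Bool) (C : Fin m → Finset (Fin m)) (i₀ : Fin m) (P : Finset (Fin m))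
    (h0 : i₀ ∈ P ↔ e = true) (hC : ∀ i, i ≠ i₀ → C i = if i ∈ P then univ else ∅) :
    linkCost e C = (#P : ℤ) * (m - #P) + (#(C i₀ \ P) + #(P \ C i₀)) := by
  -- The first product counts the cut edges of the complete graph with all letters on their side in
  -- `P`; the next two terms are the disagreements in row `i₀`, and the last one, of total sum zero,
  -- moves the edges between `i₀` and the other side of the cut onto the diagonal.
  have key : ∀ i j, clashCost e C i j =
      (if i ∈ P then 1 else 0) * (1 - if j ∈ P then 1 else 0)
      + (if i = i₀ then (if j ∈ C i₀ ∧ j ∉ P then 1 else 0) else 0)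
      + (if j = i₀ then (if i ∈ P ∧ i ∉ C i₀ then 1 else 0) else 0)
      + ((if i = j then 1 else 0) * (if e then (1 - if j ∈ P then 1 else 0) else
          if i ∈ P then 1 else 0)
        - if e then (if i = i₀ then 1 - (if j ∈ P then 1 else 0) else 0) else
          if j = i₀ then (if i ∈ P then 1 else 0) else 0) := by
    intro i j
    unfold clashCost
    by_cases hij : i = j
    · subst hij
      by_cases hi : i = i₀
      · subst hi
        cases e <;> by_cases h1 : i ∈ C i <;> simp_all
      · rw [hC i hi]
        cases e <;> by_cases h1 : i ∈ P <;> simp [h1, hi]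
    · by_cases hi : i = i₀
      · subst hi
        have hj : j ≠ i := Ne.symm hij
        rw [hC j hj]
        cases e <;> by_cases h1 : j ∈ C i <;> by_cases h2 : j ∈ P <;> simp_all
      · rw [hC i hi]
        by_cases hj : j = i₀
        · subst hj
          cases e <;> by_cases h1 : i ∈ C j <;> by_cases h2 : i ∈ P <;> simp_all
        · rw [hC j hj]
          cases e <;> by_cases h1 : i ∈ P <;> by_cases h2 : j ∈ P <;> simp_all
  have hP : (∑ j, if j ∈ P then (1 : ℤ) else 0) = #P := by simp
  have hP' : (∑ j, (1 - if j ∈ P then (1 : ℤ) else 0)) = m - #P := by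
    rw [sum_sub_distrib, hP]; simp
  have h1 : ∑ i, ∑ j, (if i ∈ P then (1 : ℤ) else 0) * (1 - if j ∈ P then 1 else 0)
      = #P * (m - #P) := by
    rw [← sum_mul_sum, hP, hP']
  unfold linkCost
  simp only [key, sum_add_distrib, sum_sub_distrib]
  simp only [← sum_ite_sdiff]
  rw [h1, sum_comm
    (f := fun i j => if j = i₀ then (if i ∈ P ∧ i ∉ C i₀ then (1 : ℤ) else 0) else 0)]
  cases e
  · rw [sum_comm (f := fun i j => if (false : Bool) then
          (if i = i₀ then (1 : ℤ) - (if j ∈ P then 1 else 0) else 0) else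
          if j = i₀ then (if i ∈ P then 1 else 0) else 0)]
    simp [ite_and, add_assoc]
  · simp [ite_and, add_assoc, sum_sub_distrib]

/-! ### Merging slices -/

/-- The properties of the boundary size `θ` and the corner number `q` of the initial segments of
`S(n,m)`, with `N = mⁿ`, on which the merging argument rests. The fields `merge_lt` and `merge_ge` are
subadditivity+σ, written without subtraction of values. -/
structure MergeData (m N : ℕ) (θ q : ℕ → ℕ) : Prop where
  θ_zero : θ 0 = 0
  θ_top : θ N = 0
  q_zero : q 0 = 0
  q_top : q N = m
  q_mono : Monotone q
  merge_lt : ∀ a b, 0 < b → b ≤ a → a < N → a + b < N →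
    θ (a + b) + (q b + q (a + b)) ≤ θ a + θ b + q a
  merge_ge : ∀ a b, 0 < b → b ≤ a → a < N → N ≤ a + b →
    θ (a + b - N) + (q b + m) ≤ θ a + θ b + (q a + q (a + b - N))

theorem sum_sub_sum_of_eq_off_pair {ι : Type*} [Fintype ι] [DecidableEq ι] (f g : ι → ℤ) {i j : ι}
    (hij : i ≠ j) (h : ∀ k, k ≠ i → k ≠ j → f k = g k) :
    ∑ k, f k = ∑ k, g k + (f i - g i) + (f j - g j) := by
  have := Fintype.sum_eq_add (f := fun k => f k - g k) i j hij
    (fun k hk => by simp [h k hk.1 hk.2])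
  rw [sum_sub_distrib] at this
  linarith

/-- Moving vertices from slice `j` to slice `i` does not raise the total cost if `θ` drops by at least
`(q x - q (a i)) + (q (a j) - q y)`: row `i` is enlarged and row `j` is shrunk. -/
theorem exists_transfer (e : Bool) {q θ : ℕ → ℕ} (hq : Monotone q) (a : Fin m → ℕ)
    (C : Fin m → Finset (Fin m)) (hC : ∀ k, #(C k) = q (a k)) {i j : Fin m} (hij : i ≠ j)
    {x y : ℕ} (hx : a i ≤ x) (hy : y ≤ a j) (hxy : x + y = a i + a j) (hxm : q x ≤ m)
    (hle : θ x + θ y + (q (a j) + q x) ≤ θ (a i) + θ (a j) + (q (a i) + q y)) :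
    ∃ (a' : Fin m → ℕ) (C' : Fin m → Finset (Fin m)),
      a' i = x ∧ a' j = y ∧ (∀ k, k ≠ i → k ≠ j → a' k = a k) ∧ ∑ k, a' k = ∑ k, a k ∧
      (∀ k, #(C' k) = q (a' k)) ∧
      ∑ k, (θ (a' k) : ℤ) + linkCost e C' ≤ ∑ k, (θ (a k) : ℤ) + linkCost e C := by
  obtain ⟨D, hD, hDc⟩ := exists_superset_card_eq (s := C i) (n := q x)
    (by rw [hC]; exact hq hx) (by simpa using hxm)
  obtain ⟨E, hE, hEc⟩ := exists_subset_card_eq (s := C j) (n := q y)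
    (by rw [hC]; exact hq hy)
  set a' : Fin m → ℕ := fun k => if k = i then x else if k = j then y else a k with ha'
  set C' : Fin m → Finset (Fin m) := fun k => if k = i then D else if k = j then E else C k with hC'
  have hai : a' i = x := by simp [ha']
  have haj : a' j = y := by simp [ha', hij.symm]
  have hak : ∀ k, k ≠ i → k ≠ j → a' k = a k := fun k h1 h2 => by simp [ha', h1, h2]
  have hCi : C' i = D := by simp [hC']
  have hCj : C' j = E := by simp [hC', hij.symm]
  have hCk : ∀ k, k ≠ i → k ≠ j → C' k = C k := fun k h1 h2 => by simp [hC', h1, h2]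
  clear_value a' C'
  refine ⟨a', C', hai, haj, hak, ?_, ?_, ?_⟩
  · have := sum_sub_sum_of_eq_off_pair (fun k => (a' k : ℤ)) (fun k => (a k : ℤ)) hij
      (fun k h1 h2 => by simp [hak k h1 h2])
    simp only [hai, haj] at this
    zify
    rw [this]
    have : (x : ℤ) + y = a i + a j := by exact_mod_cast hxy
    linarith
  · intro k
    by_cases h1 : k = i
    · subst h1; rw [hCi, hai, hDc]
    · by_cases h2 : k = j
      · subst h2; rw [hCj, haj, hEc]
      · rw [hCk k h1 h2, hak k h1 h2, hC]
  · have h1 := sum_sub_sum_of_eq_off_pair (fun k => (θ (a' k) : ℤ)) (fun k => (θ (a k) : ℤ)) hij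
      (fun k h1 h2 => by simp [hak k h1 h2])
    have h2 := Fintype.sum_eq_add (f := fun k => (#(C' k \ C k) : ℤ) + #(C k \ C' k)) i j hij
      (fun k hk => by simp [hCk k hk.1 hk.2])
    have h3 := linkCost_le_add e C' C
    rw [h2] at h3
    simp only [hai, haj] at h1
    simp only [hCi, hCj, sdiff_eq_empty_iff_subset.2 hD, sdiff_eq_empty_iff_subset.2 hE,
      card_empty] at h3
    have h4 : #(D \ C i) + q (a i) = q x := by
      rw [← hC, ← hDc]; exact card_sdiff_add_card_eq_card hD
    have h5 : #(C j \ E) + q y = q (a j) := by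
      rw [← hC, ← hEc]; exact card_sdiff_add_card_eq_card hE
    rw [h1]
    zify at hle h4 h5
    push_cast at h3
    linarith

/-- Two slices that are neither full nor empty can be merged, leaving fewer of these. -/
theorem exists_merge (e : Bool) {N : ℕ} {q θ : ℕ → ℕ} (H : MergeData m N θ q) (a : Fin m → ℕ)
    (haN : ∀ k, a k ≤ N) (C : Fin m → Finset (Fin m)) (hC : ∀ k, #(C k) = q (a k)) {i j : Fin m}
    (hij : i ≠ j) (hj : 0 < a j) (hji : a j ≤ a i) (hi : a i < N) :
    ∃ (a' : Fin m → ℕ) (C' : Fin m → Finset (Fin m)), (∀ k, a' k ≤ N) ∧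
      #{k | 0 < a' k ∧ a' k < N} < #{k | 0 < a k ∧ a k < N} ∧ ∑ k, a' k = ∑ k, a k ∧
      (∀ k, #(C' k) = q (a' k)) ∧
      ∑ k, (θ (a' k) : ℤ) + linkCost e C' ≤ ∑ k, (θ (a k) : ℤ) + linkCost e C := by
  have aux : ∃ x y, a i ≤ x ∧ y ≤ a j ∧ x + y = a i + a j ∧ x ≤ N ∧ (x = N ∨ y = 0) ∧
      θ x + θ y + (q (a j) + q x) ≤ θ (a i) + θ (a j) + (q (a i) + q y) := by
    rcases lt_or_ge (a i + a j) N with h | h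
    · refine ⟨a i + a j, 0, by omega, by omega, by omega, by omega, Or.inr rfl, ?_⟩
      have := H.merge_lt _ _ hj hji hi h
      rw [H.θ_zero, H.q_zero]
      omega
    · refine ⟨N, a i + a j - N, by omega, by omega, by omega, by omega, Or.inl rfl, ?_⟩
      have := H.merge_ge _ _ hj hji hi h
      rw [H.θ_top, H.q_top]
      omega
  obtain ⟨x, y, hx, hy, hxy, hxN, hor, hle⟩ := aux
  obtain ⟨a', C', hai, haj, hak, hsum, hC', hcost⟩ :=
    exists_transfer e H.q_mono a C hC hij hx hy hxy ((H.q_mono hxN).trans_eq H.q_top) hle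
  refine ⟨a', C', fun k => ?_, ?_, hsum, hC', hcost⟩
  · by_cases h1 : k = i
    · subst h1; rw [hai]; exact hxN
    · by_cases h2 : k = j
      · subst h2; rw [haj]; exact hy.trans (haN k)
      · rw [hak k h1 h2]; exact haN k
  · refine card_lt_card ((ssubset_iff_of_subset fun k hk => ?_).2 ?_)
    · simp only [mem_filter, mem_univ, true_and] at hk ⊢
      by_cases h1 : k = i
      · subst h1; omega
      · by_cases h2 : k = j
        · subst h2; omega
        · rwa [← hak k h1 h2]
    · rcases hor with h | h
      · exact ⟨i, by simp; omega, by simp; omega⟩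
      · exact ⟨j, by simp; omega, by simp; omega⟩

theorem card_sub_card_abs_le (A B : Finset (Fin m)) :
    |(#B : ℤ) - #A| ≤ #(A \ B) + #(B \ A) := by
  have h1 := card_sdiff_add_card_inter A B
  have h2 := card_sdiff_add_card_inter B A
  rw [inter_comm] at h2
  rw [abs_le]
  omega

/-- The total cost of `p` full slices, one slice which is an initial segment of size `r`, and empty
slices. With the exterior vertices selected the complete graph on the letters is cut into `p + 1` and
`m - p - 1` letters, without them into `p` and `m - p`. -/
def segmentCost (m : ℕ) (θ q : ℕ → ℕ) (e : Bool) (p r : ℕ) : ℤ :=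
  θ r + (((p + e.toNat : ℕ) : ℤ) * (m - (p + e.toNat : ℕ)) + |((p + e.toNat : ℕ) : ℤ) - q r|)

/-- Repeated merging: the total cost is at least that of the initial segment of the same size. -/
theorem exists_segmentCost_le (e : Bool) {N : ℕ} {q θ : ℕ → ℕ} (H : MergeData m N θ q)
    (hm : 0 < m) (hN : 0 < N) (a : Fin m → ℕ)
    (haN : ∀ k, a k ≤ N) (C : Fin m → Finset (Fin m)) (hC : ∀ k, #(C k) = q (a k)) :
    ∃ p r, p < m ∧ r ≤ N ∧ p * N + r = ∑ k, a k ∧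
      segmentCost m θ q e p r ≤ ∑ k, (θ (a k) : ℤ) + linkCost e C := by
  induction hk : #{k | 0 < a k ∧ a k < N} using Nat.strong_induction_on generalizing a C with
  | _ c ih =>
  by_cases hpair : ∃ i j, i ≠ j ∧ (0 < a i ∧ a i < N) ∧ (0 < a j ∧ a j < N)
  · have : ∃ i j, i ≠ j ∧ 0 < a j ∧ a j ≤ a i ∧ a i < N := by
      obtain ⟨i, j, hij, hi, hj⟩ := hpair
      rcases le_total (a j) (a i) with h | h
      · exact ⟨i, j, hij, hj.1, h, hi.2⟩
      · exact ⟨j, i, hij.symm, hi.1, h, hj.2⟩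
    obtain ⟨i, j, hij, hj, hji, hi⟩ := this
    obtain ⟨a', C', haN', hlt, hsum, hC', hcost⟩ := exists_merge e H a haN C hC hij hj hji hi
    obtain ⟨p, r, hp, hr, hpr, hle⟩ := ih _ (hk ▸ hlt) a' haN' C' hC' rfl
    exact ⟨p, r, hp, hr, hpr.trans hsum, hle.trans hcost⟩
  · have : ∃ i₀, ∀ k, k ≠ i₀ → a k = 0 ∨ a k = N := by
      by_cases h : ∃ i, 0 < a i ∧ a i < N
      · obtain ⟨i, hi⟩ := h
        refine ⟨i, fun k hki => ?_⟩
        by_contra hcon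
        have := haN k
        exact hpair ⟨k, i, hki, by omega, hi⟩
      · refine ⟨⟨0, hm⟩, fun k _ => ?_⟩
        by_contra hcon
        have := haN k
        exact h ⟨k, by omega⟩
    obtain ⟨i₀, hi₀⟩ := this
    set P : Finset (Fin m) := {k | k ≠ i₀ ∧ a k = N} with hP
    set Q : Finset (Fin m) := if e then insert i₀ P else P with hQ
    have hiP : i₀ ∉ P := by simp [hP]
    have hQc : #Q = #P + e.toNat := by
      cases e <;> simp [hQ, hiP]
    have hval : ∀ k, k ≠ i₀ → a k = if k ∈ P then N else 0 := by
      intro k hk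
      rcases hi₀ k hk with h | h
      · have : k ∉ P := by simp [hP, h, hN.ne]
        rw [if_neg this, h]
      · have : k ∈ P := by simp [hP, h, hk]
        rw [if_pos this, h]
    have hlink := linkCost_eq e C i₀ Q (by cases e <;> simp [hQ, hiP]) (by
      intro k hk
      have hkQ : k ∈ Q ↔ k ∈ P := by cases e <;> simp [hQ, hk]
      have h1 := hC k
      rw [hval k hk] at h1
      by_cases hkP : k ∈ P
      · rw [if_pos hkP, H.q_top] at h1
        rw [if_pos (hkQ.2 hkP), ← card_eq_iff_eq_univ, h1, Fintype.card_fin]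
      · rw [if_neg hkP, H.q_zero, card_eq_zero] at h1
        rw [if_neg (hkQ.not.2 hkP), h1])
    refine ⟨#P, a i₀, ?_, haN _, ?_, ?_⟩
    · have := card_lt_card (ssubset_univ_iff.2 fun h => hiP (h ▸ mem_univ i₀) : P ⊂ univ)
      simpa using this
    · rw [← add_sum_erase _ _ (mem_univ i₀),
        sum_congr rfl (g := fun k => if k ∈ P then N else 0)
          (fun k hk => hval k (ne_of_mem_erase hk)), sum_ite_mem, sum_const]
      have : univ.erase i₀ ∩ P = P := by
        ext k; simp only [mem_inter, mem_erase]; grind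
      rw [this, smul_eq_mul, add_comm]
    · have hθ : ∑ k, (θ (a k) : ℤ) = θ (a i₀) :=
        Fintype.sum_eq_single _ fun k hk => by
          rcases hi₀ k hk with h | h <;> simp [h, H.θ_zero, H.θ_top]
      rw [hθ, hlink, segmentCost, ← hQc, ← hC i₀]
      have := card_sub_card_abs_le (C i₀) Q
      linarith

/-! ### Initial segments of the lexicographic order -/

theorem lexNumber_eq_card (v : Fin n → Fin m) : lexNumber v = #{w | toLex w ≤ toLex v} := by
  rw [lexNumber, ← Set.ncard_coe_finset]
  simp

theorem lexNumber_mono {v w : Fin n → Fin m} (h : toLex v ≤ toLex w) :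
    lexNumber v ≤ lexNumber w :=
  Set.ncard_le_ncard (fun _ hu => le_trans hu h) (Set.toFinite _)

theorem lexNumber_strictMono {v w : Fin n → Fin m} (h : toLex v < toLex w) :
    lexNumber v < lexNumber w :=
  Set.ncard_lt_ncard ⟨fun _ hu => le_trans hu h.le, fun hs => h.not_ge (hs (le_refl (toLex w)))⟩
    (Set.toFinite _)

theorem lexNumber_injective : Function.Injective (lexNumber : (Fin n → Fin m) → ℕ) := by
  intro v w h
  rcases lt_trichotomy (toLex v) (toLex w) with hlt | heq | hlt
  · exact absurd h (lexNumber_strictMono hlt).ne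
  · exact toLex.injective heq
  · exact absurd h (lexNumber_strictMono hlt).ne'

theorem lexNumber_pos (v : Fin n → Fin m) : 0 < lexNumber v :=
  (Set.ncard_pos (Set.toFinite _)).2 ⟨v, le_refl (toLex v)⟩

theorem lexNumber_le (v : Fin n → Fin m) : lexNumber v ≤ m ^ n := by
  rw [lexNumber_eq_card]
  exact (card_le_univ _).trans_eq (by simp)

theorem image_lexNumber : (univ : Finset (Fin n → Fin m)).image lexNumber = Icc 1 (m ^ n) := by
  refine eq_of_subset_of_card_le (fun k hk => ?_) ?_
  · obtain ⟨v, -, rfl⟩ := mem_image.1 hk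
    exact mem_Icc.2 ⟨lexNumber_pos v, lexNumber_le v⟩
  · rw [card_image_of_injective _ lexNumber_injective]
    simp

theorem mem_lexInit {ℓ : ℕ} {v : Fin n → Fin m} : v ∈ lexInit n m ℓ ↔ lexNumber v ≤ ℓ := by
  simp [lexInit]

theorem card_lexInit {ℓ : ℕ} (h : ℓ ≤ m ^ n) : #(lexInit n m ℓ) = ℓ := by
  have : (lexInit n m ℓ).image lexNumber = Icc 1 ℓ := by
    ext k
    simp only [mem_image, mem_lexInit, mem_Icc]
    constructor
    · rintro ⟨v, hv, rfl⟩
      exact ⟨lexNumber_pos v, hv⟩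
    · rintro ⟨h1, h2⟩
      have : k ∈ (univ : Finset (Fin n → Fin m)).image lexNumber := by
        rw [image_lexNumber]; exact mem_Icc.2 ⟨h1, h2.trans h⟩
      obtain ⟨v, -, rfl⟩ := mem_image.1 this
      exact ⟨v, h2, rfl⟩
  rw [← card_image_of_injective _ lexNumber_injective, this]
  simp

theorem lexInit_zero : lexInit n m 0 = ∅ :=
  card_eq_zero.1 (card_lexInit (Nat.zero_le _))

theorem lexInit_top : lexInit n m (m ^ n) = univ :=
  eq_univ_iff_forall.2 fun v => mem_lexInit.2 (lexNumber_le v)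

theorem lexInit_mono {k ℓ : ℕ} (h : k ≤ ℓ) : lexInit n m k ⊆ lexInit n m ℓ :=
  fun _ hv => mem_lexInit.2 ((mem_lexInit.1 hv).trans h)

theorem toLex_cons_le_cons {i j : Fin m} {x y : Fin n → Fin m} :
    toLex (Fin.cons i x : Fin (n + 1) → Fin m) ≤ toLex (Fin.cons j y : Fin (n + 1) → Fin m) ↔
      i < j ∨ i = j ∧ toLex x ≤ toLex y := by
  have hlt : toLex (Fin.cons i x : Fin (n + 1) → Fin m) < toLex (Fin.cons j y : Fin (n + 1) → Fin m)
      ↔ i < j ∨ i = j ∧ toLex x < toLex y := Fin.pi_lex_lt_cons_cons _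
  refine le_iff_lt_or_eq.trans ((or_congr hlt (toLex_inj.trans Fin.cons_inj)).trans ?_)
  rw [le_iff_lt_or_eq (a := toLex x), toLex_inj]
  tauto

/-- The slice of `S` in copy `i`: the words `x` with `i x ∈ S`. -/
def slice (S : Finset (Fin (n + 1) → Fin m)) (i : Fin m) : Finset (Fin n → Fin m) :=
  {x | (Fin.cons i x : Fin (n + 1) → Fin m) ∈ S}

theorem mem_slice {S : Finset (Fin (n + 1) → Fin m)} {i : Fin m} {x : Fin n → Fin m} :
    x ∈ slice S i ↔ (Fin.cons i x : Fin (n + 1) → Fin m) ∈ S := by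
  simp [slice]

theorem sum_cons {M : Type*} [AddCommMonoid M] (f : (Fin (n + 1) → Fin m) → M) :
    ∑ u, f u = ∑ i, ∑ x : Fin n → Fin m, f (Fin.cons i x : Fin (n + 1) → Fin m) := by
  rw [← (Fin.consEquiv fun _ : Fin (n + 1) => Fin m).sum_comp f, Fintype.sum_prod_type]
  rfl

theorem card_eq_sum_slice (S : Finset (Fin (n + 1) → Fin m)) : #S = ∑ i, #(slice S i) := by
  have h := sum_cons fun u => if u ∈ S then 1 else 0
  rw [← card_filter, filter_univ_mem] at h
  simp only [slice, card_filter, h]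

theorem lexNumber_cons (i : Fin m) (x : Fin n → Fin m) :
    lexNumber (Fin.cons i x : Fin (n + 1) → Fin m) = i * m ^ n + lexNumber x := by
  rw [lexNumber_eq_card, card_eq_sum_slice, lexNumber_eq_card]
  have : ∀ j, #(slice {w | toLex w ≤ toLex (Fin.cons i x : Fin (n + 1) → Fin m)} j)
      = (if j < i then m ^ n else 0) + if j = i then #{w | toLex w ≤ toLex x} else 0 := by
    intro j
    simp only [slice, mem_filter, mem_univ, true_and, toLex_cons_le_cons]
    rcases lt_trichotomy j i with h | h | h
    · simp [h, h.ne]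
    · simp [h]
    · simp [h.not_gt, h.ne']
  have hi : #{j : Fin m | j < i} = i := by rw [← Fin.card_Iio]; congr 1; ext; simp
  simp only [this, sum_add_distrib, ← sum_filter, sum_const, hi]
  simp [filter_eq']

/-- The value `r = mⁿ` is included, so an initial segment whose size is a multiple of `mⁿ` may be
described with slice `p` full or with slice `p` empty. -/
theorem slice_lexInit {p r : ℕ} (hr : r ≤ m ^ n) (i : Fin m) :
    slice (lexInit (n + 1) m (p * m ^ n + r)) i =
      if (i : ℕ) < p then univ else if (i : ℕ) = p then lexInit n m r else ∅ := by
  ext x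
  rw [mem_slice, mem_lexInit, lexNumber_cons]
  have h1 := lexNumber_pos x
  have h2 := lexNumber_le x
  split_ifs with hlt heq
  · have : ((i : ℕ) + 1) * m ^ n ≤ p * m ^ n := Nat.mul_le_mul_right _ hlt
    simp only [mem_univ, iff_true]
    linarith
  · rw [heq, mem_lexInit]; omega
  · have : (p + 1) * m ^ n ≤ i * m ^ n := Nat.mul_le_mul_right _ (by omega)
    simp only [notMem_empty, iff_false]
    intro h
    linarith

/-! ### Corners -/

/-- The letters `i` whose corner `iⁿ` lies in `S`. For `n = 0` every letter names the only vertex. -/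
def cornerLetters (S : Finset (Fin n → Fin m)) : Finset (Fin m) := {i | corner n i ∈ S}

theorem mem_cornerLetters {S : Finset (Fin n → Fin m)} {i : Fin m} :
    i ∈ cornerLetters S ↔ corner n i ∈ S := by
  simp [cornerLetters]

theorem cornerLetters_mono {S T : Finset (Fin n → Fin m)} (h : S ⊆ T) :
    cornerLetters S ⊆ cornerLetters T :=
  fun _ hi => mem_cornerLetters.2 (h (mem_cornerLetters.1 hi))

theorem cornerLetters_univ : cornerLetters (univ : Finset (Fin n → Fin m)) = univ := by
  simp [cornerLetters]

theorem cornerLetters_empty : cornerLetters (∅ : Finset (Fin n → Fin m)) = ∅ := by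
  simp [cornerLetters]

theorem isLowerSet_cornerLetters (ℓ : ℕ) :
    IsLowerSet (cornerLetters (lexInit n m ℓ) : Set (Fin m)) := by
  intro i j hji hi
  rw [mem_coe, mem_cornerLetters, mem_lexInit] at *
  exact (lexNumber_mono (Pi.toLex_monotone fun _ => hji)).trans hi

theorem cornerCount_eq (hn : 1 ≤ n) (ℓ : ℕ) :
    cornerCount n m ℓ = #(cornerLetters (lexInit n m ℓ)) := by
  have hinj : Function.Injective (corner n : Fin m → Fin n → Fin m) :=
    fun i j h => congrFun h ⟨0, hn⟩
  rw [cornerCount, ← card_image_of_injective _ hinj, ← Set.ncard_coe_finset]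
  congr 1
  ext v
  simp only [Set.mem_ofPred_eq, coe_image, Set.mem_image, mem_coe, mem_cornerLetters]
  constructor
  · rintro ⟨h, i, rfl⟩
    exact ⟨i, h, rfl⟩
  · rintro ⟨i, h, rfl⟩
    exact ⟨h, i, rfl⟩

theorem corner_succ (i : Fin m) : corner (n + 1) i = Fin.cons i (corner n i) := by
  ext k
  refine Fin.cases ?_ (fun k => ?_) k <;> simp [corner]

theorem mem_cornerLetters_succ {S : Finset (Fin (n + 1) → Fin m)} {i : Fin m} :
    i ∈ cornerLetters S ↔ i ∈ cornerLetters (slice S i) := by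
  rw [mem_cornerLetters, mem_cornerLetters, mem_slice, corner_succ]

/-! ### Cutting the Sierpinski graph into copies -/

theorem sierpinski_adj_cons {i j : Fin m} {x y : Fin n → Fin m} :
    (sierpinski (n + 1) m).Adj (Fin.cons i x) (Fin.cons j y) ↔
      i = j ∧ (sierpinski n m).Adj x y ∨ i ≠ j ∧ x = corner n j ∧ y = corner n i := by
  simp only [sierpinski, Fin.exists_fin_succ, Fin.forall_fin_succ, Fin.cons_zero, Fin.cons_succ,
    Fin.not_lt_zero, Fin.succ_pos, Fin.succ_lt_succ_iff, false_imp_iff, true_imp_iff, true_and,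
    implies_true, lt_irrefl, funext_iff, corner, forall_and]
  constructor
  · rintro (h | ⟨h, h1, h2, h3⟩)
    · exact Or.inr h
    · exact Or.inl ⟨h1.1, h, h1.2, h2, h3⟩
  · rintro (⟨h, k, h1, h2, h3⟩ | h)
    · exact Or.inr ⟨k, ⟨h, h1⟩, h2, h3⟩
    · exact Or.inl h

/-- The size of the edge-boundary of `S` in `S(n,m)`. -/
noncomputable def boundaryCard (S : Finset (Fin n → Fin m)) : ℕ :=
  (edgeBoundary (sierpinski n m) (S : Set (Fin n → Fin m))).ncard

theorem boundaryCard_succ (S : Finset (Fin (n + 1) → Fin m)) :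
    (boundaryCard S : ℤ) = ∑ i, (boundaryCard (slice S i) : ℤ) +
      ∑ i, ∑ j, if j ∈ cornerLetters (slice S i) ∧ i ∉ cornerLetters (slice S j)
        then 1 else 0 := by
  classical
  simp only [boundaryCard, edgeBoundary_ncard, sum_cons, mem_coe, sierpinski_adj_cons, ← mem_slice]
  rw [← sum_add_distrib]
  refine sum_congr rfl fun i _ => ?_
  have h : ∀ j, ∑ x, ∑ y, (if x ∈ slice S i ∧ y ∉ slice S j ∧ (i = j ∧ (sierpinski n m).Adj x y ∨
        i ≠ j ∧ x = corner n j ∧ y = corner n i) then (1 : ℤ) else 0)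
      = (if i = j then ∑ x, ∑ y, (if x ∈ slice S i ∧ y ∉ slice S i ∧ (sierpinski n m).Adj x y
          then 1 else 0) else 0)
        + if j ∈ cornerLetters (slice S i) ∧ i ∉ cornerLetters (slice S j) then 1 else 0 := by
    intro j
    by_cases hij : i = j
    · subst hij
      simp
    · simp only [hij, mem_cornerLetters]
      rw [Fintype.sum_eq_single (corner n j), Fintype.sum_eq_single (corner n i)]
      · simp [hij]
      · intro y hy; simp [hy]
      · intro x hx; simp [hx]
  rw [sum_comm]
  simp only [h, sum_add_distrib]
  simp

/-- The number of exterior edges at `S` that are cut when every corner has an exterior vertex, all of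
them selected (`e = true`) or none (`e = false`). -/
def cornerCost (e : Bool) (S : Finset (Fin n → Fin m)) : ℤ :=
  ∑ i, if decide (i ∈ cornerLetters S) = e then 0 else 1

theorem cornerCost_false (S : Finset (Fin n → Fin m)) :
    cornerCost false S = #(cornerLetters S) := by
  have : ∀ i, (if decide (i ∈ cornerLetters S) = false then (0 : ℤ) else 1)
      = if i ∈ cornerLetters S then 1 else 0 := fun i => by
    by_cases h : i ∈ cornerLetters S <;> simp [h]
  simp only [cornerCost, this]
  simp

theorem cornerCost_true (S : Finset (Fin n → Fin m)) :
    cornerCost true S = m - #(cornerLetters S) := by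
  have : ∀ i, (if decide (i ∈ cornerLetters S) = true then (0 : ℤ) else 1)
      = 1 - if i ∈ cornerLetters S then 1 else 0 := fun i => by
    by_cases h : i ∈ cornerLetters S <;> simp [h]
  simp only [cornerCost, this, sum_sub_distrib]
  simp

theorem boundaryCard_add_cornerCost (e : Bool) (S : Finset (Fin (n + 1) → Fin m)) :
    boundaryCard S + cornerCost e S = ∑ i, (boundaryCard (slice S i) : ℤ) +
      linkCost e fun i => cornerLetters (slice S i) := by
  rw [boundaryCard_succ, add_assoc]
  congr 1
  have h : ∀ i j, clashCost e (fun i => cornerLetters (slice S i)) i j =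
      (if j ∈ cornerLetters (slice S i) ∧ i ∉ cornerLetters (slice S j) then 1 else 0) +
      if i = j then (if decide (i ∈ cornerLetters S) = e then 0 else 1) else 0 := by
    intro i j
    by_cases hij : i = j
    · subst hij
      simp [clashCost, mem_cornerLetters_succ (S := S)]
    · simp [clashCost, hij]
  simp only [linkCost, h, sum_add_distrib, cornerCost]
  simp

/-! ### The inequality for initial segments -/

theorem card_sdiff_add_card_sdiff_of_isLowerSet {A B : Finset (Fin m)}
    (hA : IsLowerSet (A : Set (Fin m))) (hB : IsLowerSet (B : Set (Fin m))) :
    (#(A \ B) : ℤ) + #(B \ A) = |(#B : ℤ) - #A| := by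
  have h1 := card_sdiff_add_card_inter A B
  have h2 := card_sdiff_add_card_inter B A
  rw [inter_comm] at h2
  rcases hA.total hB with h | h
  · rw [inter_eq_left.2 (by exact_mod_cast h)] at h1 h2
    rw [abs_of_nonneg] <;> omega
  · rw [inter_eq_right.2 (by exact_mod_cast h)] at h1 h2
    rw [abs_of_nonpos] <;> omega

/-- Initial segments attain the lower bound of `exists_segmentCost_le`. -/
theorem lexInit_segmentCost (e : Bool) {p r : ℕ} (hp : p < m) (hr : r ≤ m ^ n) :
    boundaryCard (lexInit (n + 1) m (p * m ^ n + r)) +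
        cornerCost e (lexInit (n + 1) m (p * m ^ n + r)) =
      segmentCost m (fun ℓ => boundaryCard (lexInit n m ℓ))
        (fun ℓ => #(cornerLetters (lexInit n m ℓ))) e p r := by
  set Q : Finset (Fin m) := {i | (i : ℕ) < p + e.toNat} with hQ
  have hQc : #Q = p + e.toNat := by
    rw [hQ, Fin.card_filter_val_lt]
    cases e <;> simp <;> omega
  have hQl : IsLowerSet (Q : Set (Fin m)) := by
    intro i j hji hi
    have : (j : ℕ) ≤ i := hji
    simp only [hQ, mem_coe, mem_filter, mem_univ, true_and] at hi ⊢
    omega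
  rw [boundaryCard_add_cornerCost, linkCost_eq e _ ⟨p, hp⟩ Q, segmentCost, hQc]
  · congr 1
    · rw [Fintype.sum_eq_single ⟨p, hp⟩]
      · simp [slice_lexInit hr]
      · intro i hi
        have : (i : ℕ) ≠ p := fun h => hi (Fin.ext h)
        rw [slice_lexInit hr]
        split_ifs <;> simp [boundaryCard, edgeBoundary_empty, edgeBoundary_univ]
    · simp only [slice_lexInit hr, lt_irrefl, if_false, if_true]
      rw [card_sdiff_add_card_sdiff_of_isLowerSet (isLowerSet_cornerLetters r) hQl, hQc]
  · cases e <;> simp [hQ]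
  · intro i hi
    have : (i : ℕ) ≠ p := fun h => hi (Fin.ext h)
    simp only [slice_lexInit hr, this, if_false]
    have hiQ : i ∈ Q ↔ (i : ℕ) < p := by
      cases e <;> simp [hQ]
      omega
    simp only [hiQ]
    split_ifs
    · exact cornerLetters_univ
    · exact cornerLetters_empty

/-- For `n = 0` the merging conditions are vacuous, as `0 < a < 1` has no solution. -/
theorem mergeData_lexInit (hsub : 1 ≤ n → SubadditivePlusSigma n m) :
    MergeData m (m ^ n) (fun ℓ => boundaryCard (lexInit n m ℓ))
      (fun ℓ => #(cornerLetters (lexInit n m ℓ))) where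
  θ_zero := by simp [lexInit_zero, boundaryCard, edgeBoundary_empty]
  θ_top := by simp [lexInit_top, boundaryCard, edgeBoundary_univ]
  q_zero := by simp [lexInit_zero, cornerLetters_empty]
  q_top := by simp [lexInit_top, cornerLetters_univ]
  q_mono _ _ h := card_le_card (cornerLetters_mono (lexInit_mono h))
  merge_lt a b hb hba ha hab := by
    rcases Nat.eq_zero_or_pos n with rfl | hn
    · rw [pow_zero] at ha; omega
    · have h := (hsub hn a b ha.le hba hb).1 hab.le
      rw [sigma, if_pos hab] at h
      simp only [cornerCount_eq hn] at h
      change (boundaryCard _ : ℤ) + _ ≤ (boundaryCard _ : ℤ) + boundaryCard _ at h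
      omega
  merge_ge a b hb hba ha hab := by
    rcases Nat.eq_zero_or_pos n with rfl | hn
    · rw [pow_zero] at ha; omega
    · have h := (hsub hn a b ha.le hba hb).2 hab
      rw [sigma, if_neg hab.not_gt] at h
      simp only [cornerCount_eq hn] at h
      change (boundaryCard _ : ℤ) + _ ≤ (boundaryCard _ : ℤ) + boundaryCard _ at h
      omega

theorem exists_card_eq_of_le (A : Finset (Fin m)) {k : ℕ} (hk : k ≤ m) :
    ∃ B : Finset (Fin m), #B = k ∧ (#(B \ A) : ℤ) + #(A \ B) = |(#A : ℤ) - k| := by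
  rcases le_total #A k with h | h
  · obtain ⟨B, hAB, hB⟩ := exists_superset_card_eq h (by simpa using hk)
    refine ⟨B, hB, ?_⟩
    have := card_sdiff_add_card_eq_card hAB
    rw [sdiff_eq_empty_iff_subset.2 hAB, card_empty, abs_of_nonpos] <;> omega
  · obtain ⟨B, hBA, hB⟩ := exists_subset_card_eq h
    refine ⟨B, hB, ?_⟩
    have := card_sdiff_add_card_eq_card hBA
    rw [sdiff_eq_empty_iff_subset.2 hBA, card_empty, abs_of_nonneg] <;> omega

/-- Every `S` has at least the boundary of the initial segment of its size, and the excess is at least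
the difference of their numbers of corners. -/
theorem boundaryCard_lexInit_add_le (hm : 0 < m)
    (hsub : ∀ n : ℕ, 1 ≤ n → SubadditivePlusSigma n m) (S : Finset (Fin n → Fin m)) :
    (boundaryCard (lexInit n m #S) : ℤ) +
      |(#(cornerLetters S) : ℤ) - #(cornerLetters (lexInit n m #S))| ≤ boundaryCard S := by
  induction n with
  | zero =>
    have : lexInit 0 m #S = S := by
      rcases S.eq_empty_or_nonempty with rfl | hS
      · exact lexInit_zero
      · have hS : S = univ := eq_univ_of_forall fun x => by
          obtain ⟨y, hy⟩ := hS
          rwa [Subsingleton.elim x y]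
        subst hS
        simpa using lexInit_top (n := 0) (m := m)
    simp [this]
  | succ n ih =>
    have H := mergeData_lexInit (n := n) (m := m) (hsub n)
    have key : ∀ e, (boundaryCard (lexInit (n + 1) m #S) : ℤ) +
        cornerCost e (lexInit (n + 1) m #S) ≤ boundaryCard S + cornerCost e S := by
      intro e
      -- The rows are changed to the sizes they have for initial segments; the induction hypothesis
      -- pays for this change.
      choose C hC hCd using fun i => exists_card_eq_of_le (cornerLetters (slice S i))
        (k := #(cornerLetters (lexInit n m #(slice S i))))
        ((card_le_univ _).trans_eq (Fintype.card_fin m))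
      obtain ⟨p, r, hp, hr, hpr, hle⟩ := exists_segmentCost_le e H hm (pow_pos hm n)
        (fun i => #(slice S i)) (fun i => (card_le_univ _).trans_eq (by simp)) C hC
      rw [card_eq_sum_slice S, ← hpr, lexInit_segmentCost e hp hr, boundaryCard_add_cornerCost]
      refine hle.trans ?_
      have h1 := linkCost_le_add e C fun i => cornerLetters (slice S i)
      simp only [hCd] at h1
      have h2 := sum_le_sum fun i (_ : i ∈ univ) => ih (slice S i)
      rw [sum_add_distrib] at h2
      linarith
    have h0 := key false
    have h1 := key true
    rw [cornerCost_false, cornerCost_false] at h0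
    rw [cornerCost_true, cornerCost_true] at h1
    rw [← le_sub_iff_add_le', abs_le]
    constructor <;> linarith

/-! ### The decorated graph -/

theorem decoratedBoundary_eq (s t : ℕ) (S : Finset (Fin n → Fin m)) :
    decoratedBoundary s t S = boundaryCard S +
      #(({i | (i : ℕ) < s} : Finset (Fin m)) \ cornerLetters S) +
      #(cornerLetters S \ ({i | (i : ℕ) < s + t} : Finset (Fin m))) := by
  classical
  have hl : ∀ u, (Sum.inl u : DecoratedVertex n m s t) ∈ withExterior s t S ↔ u ∈ S := by
    simp [withExterior]
  have hr : ∀ i, (Sum.inr i : DecoratedVertex n m s t) ∈ withExterior s t S ↔ (i.1 : ℕ) < s := by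
    rintro ⟨i, hi⟩
    simp only [withExterior, Set.mem_ofPred_eq, reduceCtorEq, and_false, exists_false, false_or,
      Sum.inr.injEq]
    exact ⟨by rintro ⟨j, hj, rfl⟩; exact hj, fun h => ⟨_, h, rfl⟩⟩
  have h1 : ∀ u i, (decoratedSierpinski n m s t).Adj (.inl u) (.inr i) ↔ u = corner n i.1 :=
    fun _ _ => Iff.rfl
  have h2 : ∀ u i, (decoratedSierpinski n m s t).Adj (.inr i) (.inl u) ↔ u = corner n i.1 :=
    fun _ _ => Iff.rfl
  have h3 : ∀ u v, (decoratedSierpinski n m s t).Adj (.inl u) (.inl v) ↔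
    (sierpinski n m).Adj u v := fun _ _ => Iff.rfl
  have h4 : ∀ i j, ¬ (decoratedSierpinski n m s t).Adj (.inr i) (.inr j) := fun _ _ h => h
  have hsub : ∀ f : Fin m → ℤ, (∑ i : {i : Fin m // (i : ℕ) < s ∨ s + t ≤ (i : ℕ)}, f i) =
      ∑ i : Fin m, if (i : ℕ) < s ∨ s + t ≤ (i : ℕ) then f i else 0 := by
    intro f
    rw [← sum_filter]
    exact (sum_subtype _ (by simp) f).symm
  zify
  rw [decoratedBoundary, boundaryCard, edgeBoundary_ncard, edgeBoundary_ncard]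
  simp only [Fintype.sum_sum_type, hl, hr, h1, h2, h3, h4, and_false, if_false, sum_const_zero,
    add_zero, sum_add_distrib, mem_coe]
  rw [sum_comm (s := univ (α := Fin n → Fin m))
    (t := univ (α := {i : Fin m // (i : ℕ) < s ∨ s + t ≤ (i : ℕ)}))]
  have h5 : ∀ i : Fin m, (∑ u : Fin n → Fin m, if u ∈ S ∧ ¬ (i : ℕ) < s ∧ u = corner n i
      then (1 : ℤ) else 0) = if i ∈ cornerLetters S ∧ ¬ (i : ℕ) < s then 1 else 0 := by
    intro i
    rw [Fintype.sum_eq_single (corner n i)]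
    · simp [mem_cornerLetters]
    · intro u hu; simp [hu]
  have h6 : ∀ i : Fin m, (∑ u : Fin n → Fin m, if (i : ℕ) < s ∧ u ∉ S ∧ u = corner n i
      then (1 : ℤ) else 0) = if (i : ℕ) < s ∧ i ∉ cornerLetters S then 1 else 0 := by
    intro i
    rw [Fintype.sum_eq_single (corner n i)]
    · simp [mem_cornerLetters]
    · intro u hu; simp [hu]
  rw [hsub fun i => ∑ u : Fin n → Fin m, if u ∈ S ∧ ¬ (i : ℕ) < s ∧ u = corner n i
      then (1 : ℤ) else 0,
    hsub fun i => ∑ u : Fin n → Fin m, if (i : ℕ) < s ∧ u ∉ S ∧ u = corner n i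
      then (1 : ℤ) else 0]
  simp only [h5, h6]
  rw [← sum_ite_sdiff, ← sum_ite_sdiff, add_assoc, add_assoc, ← sum_add_distrib, ← sum_add_distrib]
  congr 1
  refine sum_congr rfl fun i _ => ?_
  by_cases h : i ∈ cornerLetters S <;> by_cases h' : (i : ℕ) < s <;>
    by_cases h'' : (i : ℕ) < s + t <;> simp [h, h'] <;> omega

end SierpinskiEIP

theorem theorem1 (m : ℕ) (hm : 2 ≤ m)
    (hsub : ∀ n : ℕ, 1 ≤ n → SierpinskiEIP.SubadditivePlusSigma n m) :
    ∀ n s t ℓ : ℕ, 1 ≤ n → s + t ≤ m → ℓ ≤ m ^ n →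
      (SierpinskiEIP.lexInit n m ℓ).card = ℓ ∧
      IsLeast
        {k : ℕ | ∃ S : Finset (Fin n → Fin m),
          S.card = ℓ ∧ k = SierpinskiEIP.decoratedBoundary s t S}
        (SierpinskiEIP.decoratedBoundary s t (SierpinskiEIP.lexInit n m ℓ)) := by
  intro n s t ℓ _ hst hℓ
  refine ⟨SierpinskiEIP.card_lexInit hℓ, ⟨_, SierpinskiEIP.card_lexInit hℓ, rfl⟩, ?_⟩
  rintro _ ⟨S, rfl, rfl⟩
  have hmain := SierpinskiEIP.boundaryCard_lexInit_add_le (by omega : 0 < m) hsub S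
  -- The letters of the initial segment are nested with `I` and `J`, which makes the exterior edges
  -- cut at it as few as its number of corners allows.
  have hlow : ∀ k, IsLowerSet ((Finset.univ.filter fun i : Fin m => (i : ℕ) < k : Finset (Fin m)) :
      Set (Fin m)) := by
    intro k i j hji hi
    have : (j : ℕ) ≤ i := hji
    simp only [Finset.mem_coe, Finset.mem_filter, Finset.mem_univ, true_and] at hi ⊢
    omega
  have hcard : ∀ k, k ≤ m → (Finset.univ.filter fun i : Fin m => (i : ℕ) < k).card = k := by
    intro k hk
    rw [Fin.card_filter_val_lt]
    omega
  rw [SierpinskiEIP.decoratedBoundary_eq, SierpinskiEIP.decoratedBoundary_eq]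
  have hL := SierpinskiEIP.isLowerSet_cornerLetters (n := n) (m := m) S.card
  set L := SierpinskiEIP.cornerLetters (SierpinskiEIP.lexInit n m S.card)
  set C := SierpinskiEIP.cornerLetters S
  set I := Finset.univ.filter fun i : Fin m => (i : ℕ) < s
  set J := Finset.univ.filter fun i : Fin m => (i : ℕ) < s + t
  have hI : I.card = s := hcard s (by omega)
  have hJ : J.card = s + t := hcard _ hst
  have e1 := SierpinskiEIP.card_sdiff_add_card_sdiff_of_isLowerSet hL (hlow s)
  have e2 := SierpinskiEIP.card_sdiff_add_card_sdiff_of_isLowerSet hL (hlow (s + t))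
  have l1 := Finset.card_sdiff_add_card_inter L I
  have l2 := Finset.card_sdiff_add_card_inter I L
  have l3 := Finset.card_sdiff_add_card_inter L J
  have l4 := Finset.card_sdiff_add_card_inter J L
  rw [Finset.inter_comm] at l2 l4
  have c1 := Finset.le_card_sdiff C I
  have c2 := Finset.le_card_sdiff J C
  change (((L \ I).card : ℤ) + (I \ L).card) = |(I.card : ℤ) - L.card| at e1
  change (((L \ J).card : ℤ) + (J \ L).card) = |(J.card : ℤ) - L.card| at e2
  have g1 := le_abs_self ((C.card : ℤ) - L.card)
  have g2 := neg_le_abs ((C.card : ℤ) - L.card)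
  rcases abs_cases ((I.card : ℤ) - L.card) with h1 | h1 <;>
    rcases abs_cases ((J.card : ℤ) - L.card) with h2 | h2 <;> omega
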